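/- **Setting.** A *Lorentzian pre-length space* $(X,\ll,\le,d,\tau)$ is a metric space $(X,d)$ with two transitive relations $\ll,\le$, where $\le$ is reflexive and $x\ll y$ implies $x\le y$, and a lower semicontinuous map $\tau:X\times X\to[0,\infty]$ such that $\tau(x,z)\ge\tau(x,y)+\tau(y,z)$ whenever $x\le y\le z$; $\tau(x,y)>0$ if and only if $x\ll y$; and $\tau(x,y)=0$ if $x\not\le y$. Write $x<y$ for $x\le y$, $x\ne y$. A *future-directed causal* (resp. *timelike*) *curve* is a non-constant locally Lipschitz map $\gamma$ from an interval to $X$ with $\gamma(s)\le\gamma(t)$ (resp. $\gamma(s)\ll\gamma(t)$) for $s<t$; for past-directed curves the relation is reversed. A *causal curve* is one of either direction. The $\tau$-length of a future-directed causal curve $\gamma:[a,b]\to X$ is $L_\tau(\gamma)=\inf\sum_{i<n}\tau(\gamma(t_i),\gamma(t_{i+1}))$ over all partitions $a=t_0<\dots<t_n=b$, and $\gamma$ is *maximal* if $L_\tau(\gamma)=\tau(\gamma(a),\gamma(b))$; for past-directed curves the arguments of $\tau$ are swapped. A causal curve on an interval $I$ is a *geodesic* if every $t\in I$ has a neighbourhood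 $[a,b]\subset I$ (relative to $I$) on which $\gamma$ is maximal. $L^d$ denotes the metric length. The space is a *Lorentzian length space* if: - (causal path connectedness) points $x\ll y$ (resp. $x<y$) are joined by a future-directed timelike (resp. causal) curve from $x$ to $y$; - (local weak causal closedness) each point has a neighbourhood $U$ on which the relation $\le_U$ is sequentially closed in $U\times U$, where $p\le_U q$ means that $p=q$ or there is a future-directed causal curve from $p$ to $q$ inside $U$; - (localizability) each point has an open neighbourhood $\Omega$ such that $L^d$ is bounded on the causal curves contained in $\Omega$, and there is a continuous $\omega:\Omega\times\Omega\to[0,\infty)$ such that $(\Omega,\ll,\le,d,\omega)$ with restricted relations and metric is a Lorentzian pre-length space; for every $y\in\Omega$ there are $z,z'\in\Omega$ with $z'\ll y\ll z$; and for all $p<q$ in $\Omega$ there is a future-directed causal curve $\gamma$ from $p$ to $q$ with $L_\tau(\gamma)\ge L_\tau(\lambda)$ for all future-directed causal curves $\lambda$ from $p$ to $q$ contained in $\Omega$, and $L_\tau(\gamma)=\omega(p,q)\le\tau(p,q)$; - $\tau(x,y)=\sup L_\tau(\gamma)$ over the future-directed causal curves $\gamma$ from $x$ to $y$ (with $\sup\emptyset=0$).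 It is *globally hyperbolic* if for every compact $K\subset X$ the lengths $L^d$ of the causal curves in $K$ are bounded, and $\{z: x\le z\le y\}$ is compact for all $x,y\in X$. **Completeness conditions.** - *Finite compactness:* for all $B>0$, all $p\ll q$ and every sequence $(x_n)$ with $q\le x_n$ and $\tau(p,x_n)\le B$ for all $n$, the sequence $(x_n)$ has an accumulation point; and likewise if $q\ll p$, $x_n\le q$ and $\tau(x_n,p)\le B$ for all $n$. - *Timelike Cauchy completeness:* every sequence $(x_n)$ with $x_n\ll x_{n+1}$ for all $n$ and $\tau(x_n,x_{n+m})\le B_n$ for all $n$ and all $m\ge1$, for some real numbers $B_n\ge0$ with $B_n\to0$, converges; and likewise if $x_{n+1}\ll x_n$ and $\tau(x_{n+m},x_n)\le B_n$. - *Condition A:* for every $c\in[0,\infty]$, all $x\ll y$ and every future inextendible future-directed causal geodesic $\gamma:[0,c)\to X$ with $\gamma(0)=y$, one has $\tau(x,\gamma(t))\to\infty$ as $t\to c$; and for all $y\ll x$ and every past inextendible past-directed causal geodesic $\gamma:[0,c)\to X$ with $\gamma(0)=y$, one has $\tau(\gamma(t),x)\to\infty$ as $t\to c$. Here a future-directed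 causal curve $\gamma:[a,b)\to X$, $b\le\infty$, is *future extendible* if after a strictly increasing continuous reparametrization it extends to a future-directed causal curve on a compact interval, i.e. there are a future-directed causal curve $\sigma:[a',b']\to X$ and an increasing bijection $\varphi:[a,b)\to[a',b')$ with $\gamma=\sigma\circ\varphi$; it is *future inextendible* otherwise. Past (in)extendibility of past-directed causal curves is defined in the same way. **Theorem.** Let $(X,\ll,\le,d,\tau)$ be a globally hyperbolic Lorentzian length space. 1. If $X$ is finitely compact, then $X$ is timelike Cauchy complete. 2. If $X$ is timelike Cauchy complete, then $X$ satisfies Condition A. -/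

import Mathlib

open Set Filter Topology
open scoped NNReal ENNReal

/-- A Lorentzian pre-length space: a causal space `(X, ≪, ≤)` on a metric space `X` together with a
time separation function `τ`. -/
structure LorentzianPreLengthSpace (X : Type*) [MetricSpace X] where
  /-- the chronological relation `≪` -/
  chron : X → X → Prop
  /-- the causal relation `≤` -/
  causal : X → X → Prop
  /-- the time separation function -/
  τ : X → X → ℝ≥0∞
  chron_trans : ∀ x y z, chron x y → chron y z → chron x z
  causal_trans : ∀ x y z, causal x y → causal y z → causal x z
  causal_refl : ∀ x, causal x x
  causal_of_chron : ∀ x y, chron x y → causal x y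
  lowerSemicontinuous_τ : LowerSemicontinuous (fun p : X × X => τ p.1 p.2)
  reverse_triangle : ∀ x y z, causal x y → causal y z → τ x y + τ y z ≤ τ x z
  τ_pos_iff : ∀ x y, 0 < τ x y ↔ chron x y
  τ_eq_zero : ∀ x y, ¬ causal x y → τ x y = 0

/-- The half-open interval `[a, b)` of real numbers, where `b = ∞` is allowed. -/
def halfOpenInterval (a : ℝ) (b : EReal) : Set ℝ := {t : ℝ | a ≤ t ∧ (t : EReal) < b}

namespace LorentzianPreLengthSpace

variable {X : Type*} [MetricSpace X] (S : LorentzianPreLengthSpace X)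

/-! ### Causal curves

A curve on an interval `I` is a function `γ : ℝ → X` of which only the values on `I` matter. -/

/-- A non-constant, locally Lipschitz curve on the interval `I` along which `r` holds between any
earlier and any later point. -/
def IsCurve (r : X → X → Prop) (γ : ℝ → X) (I : Set ℝ) : Prop :=
  I.OrdConnected ∧ (∃ s ∈ I, ∃ t ∈ I, γ s ≠ γ t) ∧ LocallyLipschitzOn I γ ∧
    ∀ s ∈ I, ∀ t ∈ I, s < t → r (γ s) (γ t)

/-- `γ` is a future-directed causal curve on `I`. -/
def IsFutureCausal (γ : ℝ → X) (I : Set ℝ) : Prop := IsCurve S.causal γ I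

/-- `γ` is a future-directed timelike curve on `I`. -/
def IsFutureTimelike (γ : ℝ → X) (I : Set ℝ) : Prop := IsCurve S.chron γ I

/-- `γ` is a past-directed causal curve on `I`. -/
def IsPastCausal (γ : ℝ → X) (I : Set ℝ) : Prop := IsCurve (fun p q => S.causal q p) γ I

/-- `γ` is a causal curve on `I`, future-directed or past-directed. -/
def IsCausal (γ : ℝ → X) (I : Set ℝ) : Prop := S.IsFutureCausal γ I ∨ S.IsPastCausal γ I

/-- `γ` restricted to `[a, b]` is a future-directed causal curve from `p` to `q`. -/
def IsFutureCausalFromTo (γ : ℝ → X) (a b : ℝ) (p q : X) : Prop :=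
  S.IsFutureCausal γ (Icc a b) ∧ γ a = p ∧ γ b = q

/-- The infimum, over all partitions `a = t₀ < t₁ < ⋯ < tₙ = b`, of
`∑ i, T (γ (t i)) (γ (t (i + 1)))`. -/
noncomputable def partitionInf (T : X → X → ℝ≥0∞) (γ : ℝ → X) (a b : ℝ) : ℝ≥0∞ :=
  ⨅ (n : ℕ) (t : Fin (n + 1) → ℝ) (_ : StrictMono t ∧ t 0 = a ∧ t (Fin.last n) = b),
    ∑ i : Fin n, T (γ (t i.castSucc)) (γ (t i.succ))

/-- The `τ`-length of a future-directed causal curve on `[a, b]`. -/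
noncomputable def futureLength (γ : ℝ → X) (a b : ℝ) : ℝ≥0∞ := partitionInf S.τ γ a b

/-- The `τ`-length of a past-directed causal curve on `[a, b]`. -/
noncomputable def pastLength (γ : ℝ → X) (a b : ℝ) : ℝ≥0∞ :=
  partitionInf (fun p q => S.τ q p) γ a b

/-- `γ` restricted to `[a, b]` is a maximal future-directed causal curve. -/
def IsFutureMaximal (γ : ℝ → X) (a b : ℝ) : Prop :=
  S.IsFutureCausal γ (Icc a b) ∧ S.futureLength γ a b = S.τ (γ a) (γ b)

/-- `γ` restricted to `[a, b]` is a maximal past-directed causal curve. -/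
def IsPastMaximal (γ : ℝ → X) (a b : ℝ) : Prop :=
  S.IsPastCausal γ (Icc a b) ∧ S.pastLength γ a b = S.τ (γ b) (γ a)

/-! ### Lorentzian length spaces -/

def CausallyPathConnected : Prop :=
  (∀ x y, S.chron x y → ∃ (a b : ℝ) (γ : ℝ → X),
    S.IsFutureTimelike γ (Icc a b) ∧ γ a = x ∧ γ b = y) ∧
  (∀ x y, S.causal x y → x ≠ y → ∃ (a b : ℝ) (γ : ℝ → X), S.IsFutureCausalFromTo γ a b x y)

/-- The relation `p ≤_U q`: the points are equal or joined by a future-directed causal curve that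
stays in `U`. -/
def CausalIn (U : Set X) (p q : X) : Prop :=
  p ∈ U ∧ q ∈ U ∧ (p = q ∨ ∃ (a b : ℝ) (γ : ℝ → X),
    S.IsFutureCausalFromTo γ a b p q ∧ MapsTo γ (Icc a b) U)

def LocallyWeaklyCausallyClosed : Prop :=
  ∀ x : X, ∃ U ∈ 𝓝 x, ∀ (p q : ℕ → X) (p₀ q₀ : X),
    (∀ n, S.CausalIn U (p n) (q n)) → p₀ ∈ U → q₀ ∈ U →
    Tendsto p atTop (𝓝 p₀) → Tendsto q atTop (𝓝 q₀) → S.CausalIn U p₀ q₀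

/-- The `d`-lengths of the causal curves contained in `A` are bounded. The `d`-length of a curve on
`[a, b]` is its variation `eVariationOn γ (Icc a b)`. -/
def BoundedCausalLengths (A : Set X) : Prop :=
  ∃ C : ℝ≥0, 0 < C ∧ ∀ (a b : ℝ) (γ : ℝ → X),
    S.IsCausal γ (Icc a b) → MapsTo γ (Icc a b) A → eVariationOn γ (Icc a b) ≤ C

def Localizable : Prop :=
  ∀ x : X, ∃ Ω : Set X, IsOpen Ω ∧ x ∈ Ω ∧
    S.BoundedCausalLengths Ω ∧
    ∃ ω : Ω → Ω → ℝ≥0, Continuous (fun p : Ω × Ω => ω p.1 p.2) ∧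
      (∃ S' : LorentzianPreLengthSpace Ω,
        (∀ p q : Ω, S'.chron p q ↔ S.chron p q) ∧
        (∀ p q : Ω, S'.causal p q ↔ S.causal p q) ∧
        (∀ p q : Ω, S'.τ p q = (ω p q : ℝ≥0∞))) ∧
      (∀ y ∈ Ω, (∃ z ∈ Ω, S.chron y z) ∧ (∃ z ∈ Ω, S.chron z y)) ∧
      ∀ p q : Ω, S.causal p q → p ≠ q →
        ∃ (a b : ℝ) (γ : ℝ → X), S.IsFutureCausalFromTo γ a b p q ∧
          (∀ (a' b' : ℝ) (l : ℝ → X), S.IsFutureCausalFromTo l a' b' p q →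
            MapsTo l (Icc a' b') Ω → S.futureLength l a' b' ≤ S.futureLength γ a b) ∧
          S.futureLength γ a b = (ω p q : ℝ≥0∞) ∧ (ω p q : ℝ≥0∞) ≤ S.τ p q

/-- `S` is a Lorentzian length space. (The supremum over the empty family is `0`.) -/
structure IsLengthSpace : Prop where
  causallyPathConnected : S.CausallyPathConnected
  locallyCausallyClosed : S.LocallyWeaklyCausallyClosed
  localizable : S.Localizable
  τ_eq_iSup : ∀ x y, S.τ x y =
    ⨆ (a : ℝ) (b : ℝ) (γ : ℝ → X) (_ : S.IsFutureCausalFromTo γ a b x y), S.futureLength γ a b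

/-! ### Global hyperbolicity -/

def NonTotallyImprisoning : Prop := ∀ K : Set X, IsCompact K → S.BoundedCausalLengths K

/-- Non-total imprisonment together with compactness of the causal diamonds `J(x, y)`. -/
def GloballyHyperbolic : Prop :=
  S.NonTotallyImprisoning ∧ ∀ x y, IsCompact {z : X | S.causal x z ∧ S.causal z y}

/-! ### The completeness conditions -/

/-- Finite compactness (accumulation points of a sequence are its cluster points). -/
def FinitelyCompact : Prop :=
  (∀ (B : ℝ≥0) (p q : X) (x : ℕ → X), 0 < B → S.chron p q →
    (∀ n, S.causal q (x n)) → (∀ n, S.τ p (x n) ≤ B) → ∃ z, MapClusterPt z atTop x) ∧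
  (∀ (B : ℝ≥0) (p q : X) (x : ℕ → X), 0 < B → S.chron q p →
    (∀ n, S.causal (x n) q) → (∀ n, S.τ (x n) p ≤ B) → ∃ z, MapClusterPt z atTop x)

def TimelikeCauchyComplete : Prop :=
  (∀ (x : ℕ → X) (B : ℕ → ℝ≥0), (∀ n, S.chron (x n) (x (n + 1))) →
    (∀ n m, 0 < m → S.τ (x n) (x (n + m)) ≤ B n) → Tendsto B atTop (𝓝 0) →
    ∃ z, Tendsto x atTop (𝓝 z)) ∧
  (∀ (x : ℕ → X) (B : ℕ → ℝ≥0), (∀ n, S.chron (x (n + 1)) (x n)) →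
    (∀ n m, 0 < m → S.τ (x (n + m)) (x n) ≤ B n) → Tendsto B atTop (𝓝 0) →
    ∃ z, Tendsto x atTop (𝓝 z))

/-- `γ` is a reparametrization of `σ`, the former on `[a, b)` and the latter on `[a', b')`. -/
def IsReparametrization (γ : ℝ → X) (a : ℝ) (b : EReal) (σ : ℝ → X) (a' b' : ℝ) : Prop :=
  ∃ φ : ℝ → ℝ, StrictMonoOn φ (halfOpenInterval a b) ∧
    φ '' halfOpenInterval a b = Ico a' b' ∧ ∀ t ∈ halfOpenInterval a b, γ t = σ (φ t)

/-- The future-directed causal curve `γ` on `[a, b)` extends, after a reparametrization, to a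
future-directed causal curve on a compact interval `[a', b']`. The reparametrization is what gives
a meaning to the added end point for `b = ∞`, and it makes the notion independent of the speed at
which `γ` is traversed. -/
def FutureExtendible (γ : ℝ → X) (a : ℝ) (b : EReal) : Prop :=
  ∃ (a' b' : ℝ) (σ : ℝ → X), S.IsFutureCausal σ (Icc a' b') ∧ IsReparametrization γ a b σ a' b'

/-- The analogue of `FutureExtendible` for past-directed causal curves on `[a, b)`. -/
def PastExtendible (γ : ℝ → X) (a : ℝ) (b : EReal) : Prop :=
  ∃ (a' b' : ℝ) (σ : ℝ → X), S.IsPastCausal σ (Icc a' b') ∧ IsReparametrization γ a b σ a' b'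

/-- Future-directed causal geodesics: every parameter has a neighbourhood `[a, b]` in `I` on which
`γ` is maximal. -/
def IsFutureGeodesic (γ : ℝ → X) (I : Set ℝ) : Prop :=
  S.IsFutureCausal γ I ∧
    ∀ t ∈ I, ∃ a b : ℝ, Icc a b ⊆ I ∧ t ∈ Icc a b ∧ Icc a b ∈ 𝓝[I] t ∧ S.IsFutureMaximal γ a b

/-- Past-directed causal geodesics. -/
def IsPastGeodesic (γ : ℝ → X) (I : Set ℝ) : Prop :=
  S.IsPastCausal γ I ∧
    ∀ t ∈ I, ∃ a b : ℝ, Icc a b ⊆ I ∧ t ∈ Icc a b ∧ Icc a b ∈ 𝓝[I] t ∧ S.IsPastMaximal γ a b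

/-- Beem's Condition A. The filter `comap (↑) (𝓝[<] c)` on `ℝ` expresses `t → c` from below, where
`c` may be `∞`. -/
def ConditionA : Prop :=
  (∀ (c : EReal) (x y : X) (γ : ℝ → X), 0 ≤ c → S.chron x y →
    S.IsFutureGeodesic γ (halfOpenInterval 0 c) → ¬ S.FutureExtendible γ 0 c → γ 0 = y →
    Tendsto (fun t => S.τ x (γ t)) (comap (fun t : ℝ => (t : EReal)) (𝓝[<] c)) (𝓝 ⊤)) ∧
  (∀ (c : EReal) (x y : X) (γ : ℝ → X), 0 ≤ c → S.chron y x →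
    S.IsPastGeodesic γ (halfOpenInterval 0 c) → ¬ S.PastExtendible γ 0 c → γ 0 = y →
    Tendsto (fun t => S.τ (γ t) x) (comap (fun t : ℝ => (t : EReal)) (𝓝[<] c)) (𝓝 ⊤))

end LorentzianPreLengthSpace

/-! Global hyperbolicity enters only through `IsCausallyRegular`: causal futures and pasts are
closed, `≤` is antisymmetric, and causal curves near a point have bounded length. With these, a
limit of a causal chain is a least upper bound of the chain. So limits are unique, and compactness
of subsequences is enough for convergence.

For part 1, a chronological chain `x n` lies in the future of `x 1` with `τ (x 0)` bounded along it.
Finite compactness then gives every subsequence a cluster point, and the least upper bound property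
makes them all equal.

For part 2, `τ x` is nondecreasing along a causal curve `γ` in the future of `x`, so if it does not
tend to infinity it is bounded. The reverse triangle inequality bounds the separation of two points
of the curve by the increment of `τ x`, a Cauchy condition. Points on `γ` may fail to be
chronologically related, so a sequence on `γ` is shadowed by a timelike Cauchy sequence slightly to
its past. Hence `γ` converges at its open end, and since its length near the limit is finite it can
be reparametrized to include that limit, so it is extendible.

The past versions are the future versions in the dual space. -/

namespace LorentzianPreLengthSpace

variable {X : Type*} [MetricSpace X] (S : LorentzianPreLengthSpace X)

/-! ### Time reversal and causal regularity -/

/-- The Lorentzian pre-length space with the time orientation reversed. -/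
def dual : LorentzianPreLengthSpace X where
  chron x y := S.chron y x
  causal x y := S.causal y x
  τ x y := S.τ y x
  chron_trans x y z hxy hyz := S.chron_trans z y x hyz hxy
  causal_trans x y z hxy hyz := S.causal_trans z y x hyz hxy
  causal_refl := S.causal_refl
  causal_of_chron x y h := S.causal_of_chron y x h
  lowerSemicontinuous_τ := S.lowerSemicontinuous_τ.comp continuous_swap
  reverse_triangle x y z hxy hyz := by
    rw [add_comm]
    exact S.reverse_triangle z y x hyz hxy
  τ_pos_iff x y := S.τ_pos_iff y x
  τ_eq_zero x y := S.τ_eq_zero y x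

/-- The consequences of global hyperbolicity on which the comparison of the completeness conditions
rests. They are invariant under reversal of the time orientation. -/
structure IsCausallyRegular : Prop where
  exists_mem_nhds_right : ∀ x y, S.chron x y → ∀ U ∈ 𝓝 y, ∃ w ∈ U, S.chron x w ∧ S.chron w y
  exists_mem_nhds_left : ∀ x y, S.chron x y → ∀ U ∈ 𝓝 x, ∃ w ∈ U, S.chron x w ∧ S.chron w y
  exists_chron_right : ∀ x, ∃ y, S.chron x y
  exists_chron_left : ∀ x, ∃ y, S.chron y x
  isClosed_diamond : ∀ x y, IsClosed {z | S.causal x z ∧ S.causal z y}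
  antisymm : ∀ x y, S.causal x y → S.causal y x → x = y
  exists_boundedCausalLengths : ∀ x, ∃ U ∈ 𝓝 x, S.BoundedCausalLengths U

variable {S}

theorem IsCausallyRegular.dual (h : S.IsCausallyRegular) : S.dual.IsCausallyRegular where
  exists_mem_nhds_right x y hxy U hU :=
    let ⟨w, hw, h₁, h₂⟩ := h.exists_mem_nhds_left y x hxy U hU
    ⟨w, hw, h₂, h₁⟩
  exists_mem_nhds_left x y hxy U hU :=
    let ⟨w, hw, h₁, h₂⟩ := h.exists_mem_nhds_right y x hxy U hU
    ⟨w, hw, h₂, h₁⟩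
  exists_chron_right := h.exists_chron_left
  exists_chron_left := h.exists_chron_right
  isClosed_diamond x y := by
    simpa only [LorentzianPreLengthSpace.dual, and_comm] using h.isClosed_diamond y x
  antisymm x y hxy hyx := h.antisymm x y hyx hxy
  exists_boundedCausalLengths x :=
    let ⟨U, hU, C, hC, hb⟩ := h.exists_boundedCausalLengths x
    ⟨U, hU, C, hC, fun a b γ hγ hm => hb a b γ hγ.symm hm⟩

/-! ### Causal regularity from global hyperbolicity -/

/-- Interior points of a timelike curve from `x` to `y` tend to each end point by continuity. -/
theorem CausallyPathConnected.exists_mem_nhds (h : S.CausallyPathConnected) {x y : X}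
    (hxy : S.chron x y) :
    (∀ U ∈ 𝓝 y, ∃ w ∈ U, S.chron x w ∧ S.chron w y) ∧
      ∀ U ∈ 𝓝 x, ∃ w ∈ U, S.chron x w ∧ S.chron w y := by
  obtain ⟨a, b, γ, ⟨-, ⟨s, hs, t, ht, hst⟩, hlip, hr⟩, rfl, rfl⟩ := h.1 x y hxy
  have hab : a < b := by
    rcases (hs.1.trans hs.2).lt_or_eq with hab | rfl
    · exact hab
    · exact absurd (by rw [le_antisymm hs.2 hs.1, le_antisymm ht.2 ht.1]) hst
  have ha : a ∈ Icc a b := left_mem_Icc.2 hab.le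
  have hb : b ∈ Icc a b := right_mem_Icc.2 hab.le
  have hbetween : ∀ t ∈ Ioo a b, S.chron (γ a) (γ t) ∧ S.chron (γ t) (γ b) := fun t ht =>
    ⟨hr a ha t (Ioo_subset_Icc_self ht) ht.1, hr t (Ioo_subset_Icc_self ht) b hb ht.2⟩
  constructor
  · intro U hU
    have hc : Tendsto γ (𝓝[<] b) (𝓝 (γ b)) := by
      rw [← nhdsWithin_Ioo_eq_nhdsLT hab]
      exact (hlip.continuousOn b hb).mono_left (nhdsWithin_mono _ Ioo_subset_Icc_self)
    obtain ⟨t, htU, ht⟩ := ((hc.eventually_mem hU).and (Ioo_mem_nhdsLT hab)).exists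
    exact ⟨γ t, htU, hbetween t ht⟩
  · intro U hU
    have hc : Tendsto γ (𝓝[>] a) (𝓝 (γ a)) := by
      rw [← nhdsWithin_Ioo_eq_nhdsGT hab]
      exact (hlip.continuousOn a ha).mono_left (nhdsWithin_mono _ Ioo_subset_Icc_self)
    obtain ⟨t, htU, ht⟩ := ((hc.eventually_mem hU).and (Ioo_mem_nhdsGT hab)).exists
    exact ⟨γ t, htU, hbetween t ht⟩

/-- If `x ≤ y ≤ x` with `x ≠ y`, any two points of a causal curve from `x` to `y` are causally
related both ways, and all lie in the compact diamond `J(x, x)`. Oscillating `n` times along it,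
with a cosine to stay locally Lipschitz, is again a causal curve. Its length is at least `n` times
the distance from `x` to `y`, against the bound on lengths in a compact set. -/
theorem GloballyHyperbolic.antisymm (hgh : S.GloballyHyperbolic) (hcp : S.CausallyPathConnected)
    {x y : X} (hxy : S.causal x y) (hyx : S.causal y x) : x = y := by
  by_contra hne
  obtain ⟨a, b, γ, ⟨-, ⟨s, hs, -⟩, hlip, hr⟩, rfl, rfl⟩ := hcp.2 x y hxy hne
  have hab : a ≤ b := hs.1.trans hs.2
  have hJ : ∀ t ∈ Icc a b, S.causal (γ a) (γ t) ∧ S.causal (γ t) (γ a) := by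
    intro t ht
    refine ⟨?_, S.causal_trans _ (γ b) _ ?_ hyx⟩
    · rcases ht.1.eq_or_lt with rfl | hat
      · exact S.causal_refl _
      · exact hr a (left_mem_Icc.2 hab) t ht hat
    · rcases ht.2.eq_or_lt with rfl | htb
      · exact S.causal_refl _
      · exact hr t ht b (right_mem_Icc.2 hab) htb
  obtain ⟨C, -, hC⟩ := hgh.1 _ (hgh.2 (γ a) (γ a))
  obtain ⟨n, hn⟩ := ENNReal.exists_nat_mul_gt (edist_pos.2 hne).ne' (ENNReal.coe_ne_top (r := C))
  have hn0 : n ≠ 0 := by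
    rintro rfl
    simp at hn
  -- All points of `γ` are causally related to each other, so that one may run back and forth.
  set g : ℝ → ℝ := fun t => a + (b - a) * ((1 - Real.cos t) / 2) with hg
  have hgmem : ∀ t, g t ∈ Icc a b := by
    intro t
    have h₁ := Real.neg_one_le_cos t
    have h₂ := Real.cos_le_one t
    constructor <;> simp only [hg] <;> nlinarith
  have hgpi : ∀ i : ℕ, edist (γ (g ((i + 1 : ℕ) * Real.pi))) (γ (g (i * Real.pi))) =
      edist (γ a) (γ b) := by
    intro i
    have hgi : ∀ j : ℕ, g (j * Real.pi) = a + (b - a) * ((1 - (-1) ^ j) / 2) := by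
      intro j
      simp only [hg, Real.cos_nat_mul_pi]
    rw [hgi, hgi]
    rcases Nat.even_or_odd i with hi | hi
    · rw [hi.neg_one_pow, hi.add_one.neg_one_pow, edist_comm]
      norm_num
    · rw [hi.neg_one_pow, hi.add_one.neg_one_pow]
      norm_num
  have hglip : LocallyLipschitz g := by
    refine ContDiff.locallyLipschitz (𝕂 := ℝ) ?_
    fun_prop
  obtain ⟨K, hK⟩ := hlip.exists_lipschitzOnWith_of_compact isCompact_Icc
  have hcausal : S.IsCausal (γ ∘ g) (Icc 0 (n * Real.pi)) := by
    refine Or.inl ⟨ordConnected_Icc, ⟨0, ⟨le_rfl, by positivity⟩, Real.pi, ⟨Real.pi_pos.le, ?_⟩, ?_⟩,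
      ?_, fun s _ t _ _ => S.causal_trans _ _ _ (hJ _ (hgmem s)).2 (hJ _ (hgmem t)).1⟩
    · have : (1 : ℝ) ≤ n := by exact_mod_cast Nat.one_le_iff_ne_zero.2 hn0
      nlinarith [Real.pi_pos]
    · simpa [hg] using hne
    · intro t _
      obtain ⟨K', V, hV, hK'⟩ := hglip t
      exact ⟨K * K', V, mem_nhdsWithin_of_mem_nhds hV, hK.comp hK' fun u _ => hgmem u⟩
  have hvar := hC 0 (n * Real.pi) (γ ∘ g) hcausal fun t _ => hJ _ (hgmem t)
  refine absurd hvar (not_le.2 (hn.trans_le ?_))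
  have hsum := eVariationOn.sum_le_of_monotoneOn_Iic (f := γ ∘ g) (s := Icc 0 (n * Real.pi)) (n := n)
    (u := fun i => i * Real.pi) ?_ ?_
  · simpa only [Function.comp_apply, hgpi, Finset.sum_const, Finset.card_range, nsmul_eq_mul]
      using hsum
  · intro i _ j _ hij
    exact mul_le_mul_of_nonneg_right (Nat.cast_le.2 hij) Real.pi_pos.le
  · intro i hi
    exact ⟨by positivity, mul_le_mul_of_nonneg_right (Nat.cast_le.2 hi) Real.pi_pos.le⟩

theorem IsLengthSpace.isCausallyRegular (hS : S.IsLengthSpace) (hgh : S.GloballyHyperbolic) :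
    S.IsCausallyRegular where
  exists_mem_nhds_right _ _ hxy := (hS.causallyPathConnected.exists_mem_nhds hxy).1
  exists_mem_nhds_left _ _ hxy := (hS.causallyPathConnected.exists_mem_nhds hxy).2
  exists_chron_right x := by
    obtain ⟨Ω, -, hx, -, ω, -, -, hchron, -⟩ := hS.localizable x
    obtain ⟨⟨y, -, hy⟩, -⟩ := hchron x hx
    exact ⟨y, hy⟩
  exists_chron_left x := by
    obtain ⟨Ω, -, hx, -, ω, -, -, hchron, -⟩ := hS.localizable x
    obtain ⟨-, y, -, hy⟩ := hchron x hx
    exact ⟨y, hy⟩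
  isClosed_diamond x y := (hgh.2 x y).isClosed
  antisymm _ _ := hgh.antisymm hS.causallyPathConnected
  exists_boundedCausalLengths x := by
    obtain ⟨Ω, hΩ, hx, hb, -⟩ := hS.localizable x
    exact ⟨Ω, hΩ.mem_nhds hx, hb⟩

/-! ### Open chronological cones, push-up and closed causal cones -/

theorem isOpen_chron_right (S : LorentzianPreLengthSpace X) (x : X) : IsOpen {y | S.chron x y} := by
  simp only [← S.τ_pos_iff]
  exact (S.lowerSemicontinuous_τ.comp (Continuous.prodMk_right x)).isOpen_preimage 0

theorem isOpen_chron_left (S : LorentzianPreLengthSpace X) (y : X) : IsOpen {x | S.chron x y} :=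
  S.dual.isOpen_chron_right y

theorem chron_of_chron_of_causal (S : LorentzianPreLengthSpace X) {x y z : X} (hxy : S.chron x y)
    (hyz : S.causal y z) : S.chron x z := by
  rw [← S.τ_pos_iff] at hxy ⊢
  exact hxy.trans_le (le_self_add.trans (S.reverse_triangle x y z (S.causal_of_chron x y
    ((S.τ_pos_iff x y).1 hxy)) hyz))

/-- Closedness is local. A point `z` of the closure has some `y` with `z ≪ y`, the past of `y` is an
open neighbourhood of `z`, and inside it the future of `x` is contained in the closed diamond `J(x,
y)`. -/
theorem IsCausallyRegular.isClosed_causal_right (h : S.IsCausallyRegular) (x : X) :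
    IsClosed {y | S.causal x y} := by
  refine isClosed_of_closure_subset fun z hz => ?_
  obtain ⟨y, hzy⟩ := h.exists_chron_right z
  have hz' := (S.isOpen_chron_left y).closure_inter ⟨hz, hzy⟩
  have := closure_minimal (t := {w | S.causal x w ∧ S.causal w y})
    (fun w hw => ⟨hw.1, S.causal_of_chron _ _ hw.2⟩) (h.isClosed_diamond x y) hz'
  exact this.1

theorem IsCausallyRegular.isClosed_causal_left (h : S.IsCausallyRegular) (y : X) :
    IsClosed {x | S.causal x y} :=
  h.dual.isClosed_causal_right y

theorem causal_of_le (S : LorentzianPreLengthSpace X) {x : ℕ → X}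
    (hx : ∀ n, S.causal (x n) (x (n + 1))) {m n : ℕ} (hmn : m ≤ n) : S.causal (x m) (x n) := by
  induction n, hmn using Nat.le_induction with
  | base => exact S.causal_refl _
  | succ n _ ih => exact S.causal_trans _ _ _ ih (hx n)

/-! ### Finite compactness implies timelike Cauchy completeness -/

/-- If causal futures are finitely compact, then a chronological chain with bounded time separations
converges, as its cluster points are causally related both ways. -/
theorem IsCausallyRegular.tendsto_of_future_finitelyCompact (h : S.IsCausallyRegular)
    (hfc : ∀ (B : ℝ≥0) (p q : X) (x : ℕ → X), 0 < B → S.chron p q →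
      (∀ n, S.causal q (x n)) → (∀ n, S.τ p (x n) ≤ B) → ∃ z, MapClusterPt z atTop x)
    {x : ℕ → X} {B : ℕ → ℝ≥0} (hx : ∀ n, S.chron (x n) (x (n + 1)))
    (hB : ∀ n m, 0 < m → S.τ (x n) (x (n + m)) ≤ B n) : ∃ z, Tendsto x atTop (𝓝 z) := by
  have hle : ∀ {m n : ℕ}, m ≤ n → S.causal (x m) (x n) := fun hmn =>
    S.causal_of_le (fun n => S.causal_of_chron _ _ (hx n)) hmn
  have hcluster : ∀ ns : ℕ → ℕ, Tendsto ns atTop atTop → ∃ z, MapClusterPt z atTop (x ∘ ns) := by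
    intro ns hns
    obtain ⟨N, hN⟩ := (hns.eventually_ge_atTop 1).exists_forall_of_atTop
    -- Finite compactness asks for a positive bound, hence `B 0 + 1`; the shift by `N` keeps the
    -- indices at least `1`, so that the points lie in the future of `x 1`.
    obtain ⟨z, hz⟩ := hfc (B 0 + 1) (x 0) (x 1) (fun n => x (ns (n + N))) (by positivity) (hx 0)
      (fun n => hle (hN _ (Nat.le_add_left _ _))) fun n => by
        have := hB 0 (ns (n + N)) (hN _ (Nat.le_add_left _ _))
        rw [zero_add] at this
        exact this.trans (by exact_mod_cast le_self_add)
    exact ⟨z, MapClusterPt.of_comp (φ := fun n => n + N) (tendsto_add_atTop_nat N) hz⟩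
  have hupper : ∀ z, MapClusterPt z atTop x → ∀ n, S.causal (x n) z := fun z hz n =>
    (h.isClosed_causal_right (x n)).mem_of_mapClusterPt hz
      ((eventually_ge_atTop n).mono fun _ hnm => hle hnm)
  -- A cluster point lies below every upper bound of the chain; with `hupper` it is the least one.
  have hunique : ∀ z z', MapClusterPt z atTop x → (∀ n, S.causal (x n) z') → S.causal z z' :=
    fun z z' hz hz' => (h.isClosed_causal_left z').mem_of_mapClusterPt hz (.of_forall hz')
  obtain ⟨z, hz⟩ := hcluster id tendsto_id
  refine ⟨z, tendsto_of_subseq_tendsto fun ns hns => ?_⟩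
  obtain ⟨z', hz'⟩ := hcluster ns hns
  have hzz' : MapClusterPt z' atTop x := hz'.of_comp hns
  obtain rfl : z' = z := h.antisymm _ _ (hunique _ _ hzz' (hupper _ hz))
    (hunique _ _ hz (hupper _ hzz'))
  obtain ⟨ms, -, hms⟩ := hz'.tendsto_subseq
  exact ⟨ms, hms⟩

/-! ### Timelike Cauchy completeness makes causal curves converge -/

/-- A causal chain on which `τ x` is bounded is approximated from the chronological past by a
timelike Cauchy sequence, hence converges. -/
theorem IsCausallyRegular.tendsto_of_future_timelikeCauchyComplete (h : S.IsCausallyRegular)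
    (htcc : ∀ (x : ℕ → X) (B : ℕ → ℝ≥0), (∀ n, S.chron (x n) (x (n + 1))) →
      (∀ n m, 0 < m → S.τ (x n) (x (n + m)) ≤ B n) → Tendsto B atTop (𝓝 0) →
      ∃ z, Tendsto x atTop (𝓝 z))
    {x : X} {y : ℕ → X} (hxy : S.chron x (y 0)) (hy : ∀ n, S.causal (y n) (y (n + 1)))
    {C : ℝ≥0∞} (hC : C ≠ ⊤) (hτ : ∀ n, S.τ x (y n) ≤ C) : ∃ z, Tendsto y atTop (𝓝 z) := by
  have hle : ∀ {m n : ℕ}, m ≤ n → S.causal (y m) (y n) := S.causal_of_le hy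
  have hxy' : ∀ n, S.chron x (y n) := fun n => S.chron_of_chron_of_causal hxy (hle n.zero_le)
  have hmono : Monotone fun n => S.τ x (y n) := fun m n hmn =>
    le_self_add.trans (S.reverse_triangle _ _ _ (S.causal_of_chron _ _ (hxy' m)) (hle hmn))
  set e : ℕ → ℝ≥0∞ := fun n => ((n : ℝ≥0∞) + 1)⁻¹ with he
  have he0 : ∀ n, e n ≠ 0 := fun n => ENNReal.inv_ne_zero.2 (by finiteness)
  have helim : Tendsto e atTop (𝓝 0) := by
    have := (tendsto_add_atTop_iff_nat 1).2 ENNReal.tendsto_inv_nat_nhds_zero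
    simpa [he] using this
  have hstep : ∀ n w, S.chron w (y n) → ∃ w', S.chron w w' ∧ S.chron w' (y n) ∧
      edist w' (y n) < e n ∧ S.τ x (y n) < S.τ x w' + e n := by
    intro n w hw
    have hlsc : {w' | S.τ x (y n) < S.τ x w' + e n} ∈ 𝓝 (y n) := by
      have hpos : S.τ x (y n) ≠ 0 := ((S.τ_pos_iff _ _).2 (hxy' n)).ne'
      have hfin : S.τ x (y n) ≠ ⊤ := ne_top_of_le_ne_top hC (hτ n)
      have hlt : S.τ x (y n) - e n < S.τ x (y n) := ENNReal.sub_lt_self hfin hpos (he0 n)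
      filter_upwards [(S.lowerSemicontinuous_τ.comp (Continuous.prodMk_right x)) (y n) _ hlt]
        with w' hw'
      exact ENNReal.lt_add_of_sub_lt_right (Or.inl hfin) hw'
    obtain ⟨w', ⟨h₁, h₂⟩, h₃, h₄⟩ := h.exists_mem_nhds_right w (y n) hw _
      (inter_mem (Metric.eball_mem_nhds (y n) (pos_iff_ne_zero.2 (he0 n))) hlsc)
    exact ⟨w', h₃, h₄, h₁, h₂⟩
  choose! f hf₁ hf₂ hf₃ hf₄ using hstep
  -- `w (n + 1)` is chosen between `w n` and `y (n + 1)`, which is possible because `w n ≪ y n ≤ y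
  -- (n + 1)`.
  set w : ℕ → X := fun n => Nat.rec (f 0 x) (fun n z => f (n + 1) z) n with hw
  have hw_succ : ∀ n, w (n + 1) = f (n + 1) (w n) := fun _ => rfl
  have hwy : ∀ n, S.chron x (w n) ∧ S.chron (w n) (y n) ∧ edist (w n) (y n) < e n ∧
      S.τ x (y n) < S.τ x (w n) + e n := by
    intro n
    induction n with
    | zero => exact ⟨hf₁ 0 x hxy, hf₂ 0 x hxy, hf₃ 0 x hxy, hf₄ 0 x hxy⟩
    | succ n ih =>
      have hwn := S.chron_of_chron_of_causal ih.2.1 (hy n)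
      exact ⟨S.chron_trans _ _ _ ih.1 (hf₁ _ _ hwn), hf₂ _ _ hwn, hf₃ _ _ hwn, hf₄ _ _ hwn⟩
  have hww : ∀ n, S.chron (w n) (w (n + 1)) := fun n =>
    hf₁ _ _ (S.chron_of_chron_of_causal (hwy n).2.1 (hy n))
  set L : ℝ≥0∞ := ⨆ n, S.τ x (y n) with hL
  have hLtop : L ≠ ⊤ := ne_top_of_le_ne_top hC (iSup_le hτ)
  have hwL : ∀ n, S.τ x (w n) ≤ L := fun n =>
    (le_self_add.trans (S.reverse_triangle _ _ _ (S.causal_of_chron _ _ (hwy n).1)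
      (S.causal_of_chron _ _ (hwy n).2.1))).trans (le_iSup (fun n => S.τ x (y n)) n)
  have hBtop : ∀ n, L - S.τ x (w n) ≠ ⊤ := fun n => ENNReal.sub_ne_top hLtop
  -- By the reverse triangle inequality `τ (w n) (w (n + m))` is at most `τ x (w (n + m)) - τ x (w
  -- n)`, hence at most `L - τ x (w n)`. This is at most `L - τ x (y n) + e n`, which tends to `0`.
  obtain ⟨z, hz⟩ := htcc w (fun n => (L - S.τ x (w n)).toNNReal) hww (fun n m _ => by
    rw [ENNReal.coe_toNNReal (hBtop n)]
    refine ENNReal.le_sub_of_add_le_left (ne_top_of_le_ne_top hLtop (hwL n)) ?_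
    exact (S.reverse_triangle _ _ _ (S.causal_of_chron _ _ (hwy n).1)
      (S.causal_of_le (fun n => S.causal_of_chron _ _ (hww n)) (Nat.le_add_right n m))).trans
        (hwL (n + m))) (by
    rw [← ENNReal.tendsto_coe]
    simp only [ENNReal.coe_toNNReal (hBtop _), ENNReal.coe_zero]
    have hlim : Tendsto (fun n => L - S.τ x (y n) + e n) atTop (𝓝 0) := by
      have := (ENNReal.Tendsto.sub (tendsto_const_nhds (x := L)) (tendsto_atTop_iSup hmono)
        (Or.inl hLtop)).add helim
      simpa [← hL] using this
    refine tendsto_of_tendsto_of_tendsto_of_le_of_le tendsto_const_nhds hlim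
      (fun _ => zero_le) fun n => ?_
    rw [tsub_le_iff_right]
    calc L ≤ L - S.τ x (y n) + S.τ x (y n) := le_tsub_add
      _ ≤ L - S.τ x (y n) + (S.τ x (w n) + e n) := by gcongr; exact (hwy n).2.2.2.le
      _ = L - S.τ x (y n) + e n + S.τ x (w n) := by ring)
  refine ⟨z, tendsto_iff_edist_tendsto_0.2 ?_⟩
  have hsum := helim.add (tendsto_iff_edist_tendsto_0.1 hz)
  rw [add_zero] at hsum
  refine tendsto_of_tendsto_of_tendsto_of_le_of_le tendsto_const_nhds hsum
    (fun _ => zero_le) fun n => ?_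
  calc edist (y n) z ≤ edist (y n) (w n) + edist (w n) z := edist_triangle _ _ _
    _ ≤ e n + edist (w n) z := by
      gcongr
      rw [edist_comm]
      exact (hwy n).2.2.1.le

theorem neBot_comap_coe_nhdsLT {c : EReal} (hc : ⊥ < c) :
    (comap (fun t : ℝ => (t : EReal)) (𝓝[<] c)).NeBot := by
  refine comap_neBot fun s hs => ?_
  obtain ⟨l, hl, hls⟩ := (mem_nhdsLT_iff_exists_Ioo_subset' hc).1 hs
  obtain ⟨t, hlt, htc⟩ := EReal.lt_iff_exists_real_btwn.1 hl
  exact ⟨t, hls ⟨hlt, htc⟩⟩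

theorem eventually_lt_comap_coe_nhdsLT {c : EReal} {t : ℝ} (ht : (t : EReal) < c) :
    ∀ᶠ s in comap (fun t : ℝ => (t : EReal)) (𝓝[<] c), t < s ∧ (s : EReal) < c := by
  filter_upwards [preimage_mem_comap (Ioo_mem_nhdsLT ht)] with s hs
  exact ⟨EReal.coe_lt_coe_iff.1 hs.1, hs.2⟩

/-- Every sequence of parameters tending to `c` has a nondecreasing subsequence, along which the
chain result applies. Two limits so obtained bound the whole curve from above, hence each other, and
antisymmetry identifies them. -/
theorem IsCausallyRegular.exists_tendsto_of_future_timelikeCauchyComplete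
    (h : S.IsCausallyRegular)
    (htcc : ∀ (x : ℕ → X) (B : ℕ → ℝ≥0), (∀ n, S.chron (x n) (x (n + 1))) →
      (∀ n m, 0 < m → S.τ (x n) (x (n + m)) ≤ B n) → Tendsto B atTop (𝓝 0) →
      ∃ z, Tendsto x atTop (𝓝 z))
    {c : EReal} (hc : 0 < c) {γ : ℝ → X} (hγ : S.IsFutureCausal γ (halfOpenInterval 0 c))
    {x : X} (hx : S.chron x (γ 0))
    {C : ℝ≥0∞} (hC : C ≠ ⊤) (hτ : ∀ t ∈ halfOpenInterval 0 c, S.τ x (γ t) ≤ C) :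
    ∃ z, Tendsto γ (comap (fun t : ℝ => (t : EReal)) (𝓝[<] c)) (𝓝 z) := by
  set F := comap (fun t : ℝ => (t : EReal)) (𝓝[<] c) with hF
  have hI0 : (0 : ℝ) ∈ halfOpenInterval 0 c := ⟨le_rfl, by exact_mod_cast hc⟩
  have hcausal : ∀ s ∈ halfOpenInterval 0 c, ∀ t ∈ halfOpenInterval 0 c, s ≤ t →
      S.causal (γ s) (γ t) := by
    intro s hs t ht hst
    rcases hst.eq_or_lt with rfl | hst
    · exact S.causal_refl _
    · exact hγ.2.2.2 s hs t ht hst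
  have hseq : ∀ u : ℕ → ℝ, Tendsto u atTop F → ∃ (φ : ℕ → ℕ) (z : X),
      Tendsto φ atTop atTop ∧ Tendsto (γ ∘ u ∘ φ) atTop (𝓝 z) := by
    intro u hu
    obtain ⟨N, hN⟩ := (hu.eventually (eventually_lt_comap_coe_nhdsLT
      (by exact_mod_cast hc : ((0 : ℝ) : EReal) < c))).exists_forall_of_atTop
    have hmem : ∀ n, u (n + N) ∈ halfOpenInterval 0 c := fun n =>
      ⟨(hN _ (Nat.le_add_left _ _)).1.le, (hN _ (Nat.le_add_left _ _)).2⟩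
    have huN : Tendsto (fun n => u (n + N)) atTop F := hu.comp (tendsto_add_atTop_nat N)
    obtain ⟨g, hg | hg⟩ := exists_increasing_or_nonincreasing_subseq (· ≤ ·) fun n => u (n + N)
    · obtain ⟨z, hz⟩ := h.tendsto_of_future_timelikeCauchyComplete htcc
        (y := fun n => γ (u (g n + N)))
        (S.chron_of_chron_of_causal hx (hcausal _ hI0 _ (hmem _) (hmem _).1))
        (fun n => hcausal _ (hmem _) _ (hmem _) (hg n (n + 1) n.lt_succ_self)) hC
        fun n => hτ _ (hmem _)
      exact ⟨fun n => g n + N, z,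
        (tendsto_add_atTop_nat N).comp g.strictMono.tendsto_atTop, hz⟩
    -- The alternative is a strictly decreasing sequence of parameters, but parameters tending to
    -- `c` eventually exceed the first one.
    · obtain ⟨n, hn, hn0⟩ := (((huN.comp g.strictMono.tendsto_atTop).eventually
        (eventually_lt_comap_coe_nhdsLT (hmem (g 0)).2)).and (eventually_gt_atTop 0)).exists
      exact absurd hn.1.le (hg 0 n hn0)
  have hupper : ∀ (u : ℕ → ℝ) (z : X), Tendsto u atTop F → Tendsto (γ ∘ u) atTop (𝓝 z) →
      ∀ t ∈ halfOpenInterval 0 c, S.causal (γ t) z := by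
    intro u z hu hz t ht
    refine (h.isClosed_causal_right (γ t)).mem_of_tendsto hz ?_
    filter_upwards [hu.eventually (eventually_lt_comap_coe_nhdsLT ht.2)] with n hn
    exact hcausal t ht _ ⟨ht.1.trans hn.1.le, hn.2⟩ hn.1.le
  have hle : ∀ (u v : ℕ → ℝ) (z z' : X), Tendsto u atTop F → Tendsto (γ ∘ u) atTop (𝓝 z) →
      Tendsto v atTop F → Tendsto (γ ∘ v) atTop (𝓝 z') → S.causal z z' := by
    intro u v z z' hu hz hv hz'
    refine (h.isClosed_causal_left z').mem_of_tendsto hz ?_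
    filter_upwards [hu.eventually (eventually_lt_comap_coe_nhdsLT hI0.2)] with n hn
    exact hupper v z' hv hz' _ ⟨hn.1.le, hn.2⟩
  have : F.NeBot := neBot_comap_coe_nhdsLT (bot_le.trans_lt hc)
  obtain ⟨u, hu⟩ := exists_seq_tendsto F
  obtain ⟨φ, z, hφ, hz⟩ := hseq u hu
  refine ⟨z, tendsto_of_seq_tendsto fun v hv => tendsto_of_subseq_tendsto fun ns hns => ?_⟩
  obtain ⟨ψ, z', hψ, hz'⟩ := hseq (v ∘ ns) (hv.comp hns)
  have hu' := hu.comp hφ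
  have hv' := (hv.comp hns).comp hψ
  obtain rfl : z = z' := h.antisymm _ _ (hle _ _ _ _ hu' hz hv' hz') (hle _ _ _ _ hv' hz' hu' hz)
  exact ⟨ψ, hz'⟩

/-! ### Extending a causal curve to its limit -/

theorem exists_eVariationOn_Icc_le_of_locallyLipschitzOn {γ : ℝ → X} {a b : ℝ}
    (hγ : LocallyLipschitzOn (Icc a b) γ) :
    ∃ K : ℝ≥0, ∀ s t, a ≤ s → s ≤ t → t ≤ b →
      eVariationOn γ (Icc s t) ≤ ENNReal.ofReal (K * (t - s)) := by
  obtain ⟨K, hK⟩ := hγ.exists_lipschitzOnWith_of_compact isCompact_Icc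
  refine ⟨K, fun s t has hst htb => ?_⟩
  have := (hK.mono (Icc_subset_Icc has htb)).comp_eVariationOn_le (g := id) (s := Icc s t)
    (mapsTo_id _)
  rw [eVariationOn_id_Icc] at this
  rwa [ENNReal.ofReal_mul K.coe_nonneg, ENNReal.ofReal_coe_nnreal]

/-- A causal curve of bounded length that converges at its open end is extendible: it is
reparametrized by its length plus a bounded strictly increasing function. -/
theorem futureExtendible_of_tendsto {c : EReal} {γ : ℝ → X}
    (hγ : S.IsFutureCausal γ (halfOpenInterval 0 c)) {z : X}
    (hz : Tendsto γ (comap (fun t : ℝ => (t : EReal)) (𝓝[<] c)) (𝓝 z))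
    (hle : ∀ t ∈ halfOpenInterval 0 c, S.causal (γ t) z)
    {C : ℝ≥0∞} (hC : C ≠ ⊤) (hvar : ∀ t ∈ halfOpenInterval 0 c, eVariationOn γ (Icc 0 t) ≤ C) :
    S.FutureExtendible γ 0 c := by
  set I := halfOpenInterval 0 c with hI
  obtain ⟨-, ⟨s₀, hs₀, t₀, ht₀, hst₀⟩, hlip, hcausal⟩ := hγ
  have hsub : ∀ {t}, t ∈ I → Icc 0 t ⊆ I := fun {t} ht s hs =>
    ⟨hs.1, (EReal.coe_le_coe_iff.2 hs.2).trans_lt ht.2⟩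
  have h0 : (0 : ℝ) ∈ I := hsub hs₀ ⟨le_rfl, hs₀.1⟩
  set v : ℝ → ℝ := fun t => (eVariationOn γ (Icc 0 t)).toReal with hv
  -- The arctangent makes `φ` strictly increasing even where `γ` is stationary, and keeps it bounded
  -- even for `c = ∞`.
  set φ : ℝ → ℝ := fun t => v t + Real.arctan t with hφ
  have hvtop : ∀ {t}, t ∈ I → eVariationOn γ (Icc 0 t) ≠ ⊤ := fun ht =>
    ne_top_of_le_ne_top hC (hvar _ ht)
  have hvsub : ∀ {s t}, 0 ≤ s → s ≤ t → t ∈ I →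
      v t = v s + (eVariationOn γ (Icc s t)).toReal := by
    intro s t hs hst ht
    have hadd := eVariationOn.Icc_add_Icc γ (s := univ) hs hst (mem_univ s)
    simp only [univ_inter] at hadd
    have hs' := hvtop (hsub ht ⟨hs, hst⟩)
    have hst' : eVariationOn γ (Icc s t) ≠ ⊤ :=
      ne_top_of_le_ne_top (hvtop ht) (eVariationOn.mono γ (Icc_subset_Icc_left hs))
    simp only [hv]
    rw [← hadd, ENNReal.toReal_add hs' hst']
  -- This estimate makes `γ ∘ φ⁻¹` 1-Lipschitz; `hdistz` carries it over to the added end point.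
  have hdist : ∀ {s t}, s ∈ I → t ∈ I → s ≤ t → dist (γ s) (γ t) ≤ φ t - φ s := by
    intro s t hs ht hst
    have hst' : eVariationOn γ (Icc s t) ≠ ⊤ :=
      ne_top_of_le_ne_top (hvtop ht) (eVariationOn.mono γ (Icc_subset_Icc_left hs.1))
    have h₁ : dist (γ s) (γ t) ≤ (eVariationOn γ (Icc s t)).toReal := by
      rw [dist_edist]
      exact ENNReal.toReal_mono hst'
        (eVariationOn.edist_le γ (left_mem_Icc.2 hst) (right_mem_Icc.2 hst))
    have h₂ := hvsub hs.1 hst ht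
    have h₃ := Real.arctan_mono hst
    simp only [hφ]
    linarith
  have hφmono : StrictMonoOn φ I := by
    intro s hs t ht hst
    have h₂ := hvsub hs.1 hst.le ht
    have h₃ := Real.arctan_strictMono hst
    have h₄ : 0 ≤ (eVariationOn γ (Icc s t)).toReal := ENNReal.toReal_nonneg
    simp only [hφ]
    linarith
  have hφcont : ∀ {t}, t ∈ I → ContinuousOn φ (Icc 0 t) := by
    intro t ht
    refine ContinuousOn.add ?_ Real.continuous_arctan.continuousOn
    obtain ⟨K, hK⟩ := exists_eVariationOn_Icc_le_of_locallyLipschitzOn (hlip.mono (hsub ht))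
    refine (LipschitzOnWith.of_le_add_mul K fun r hr s hs => ?_).continuousOn
    rcases le_total s r with hsr | hrs
    · rw [hvsub hs.1 hsr (hsub ht hr), Real.dist_eq, abs_of_nonneg (sub_nonneg.2 hsr)]
      gcongr
      exact ENNReal.toReal_le_of_le_ofReal (mul_nonneg K.2 (sub_nonneg.2 hsr))
        (hK s r hs.1 hsr hr.2)
    · rw [hvsub hr.1 hrs (hsub ht hs)]
      have : 0 ≤ (eVariationOn γ (Icc r s)).toReal := ENNReal.toReal_nonneg
      have : 0 ≤ K * dist r s := by positivity
      linarith
  have hbdd : BddAbove (φ '' I) := by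
    refine ⟨C.toReal + Real.pi / 2, ?_⟩
    rintro _ ⟨t, ht, rfl⟩
    exact add_le_add (ENNReal.toReal_mono hC (hvar t ht)) (Real.arctan_lt_pi_div_two t).le
  set b := sSup (φ '' I) with hb
  have hexists_gt : ∀ {t}, t ∈ I → ∃ s ∈ I, t < s := by
    intro t ht
    obtain ⟨s, hts, hsc⟩ := EReal.lt_iff_exists_real_btwn.1 ht.2
    have hts := EReal.coe_lt_coe_iff.1 hts
    exact ⟨s, ⟨ht.1.trans hts.le, hsc⟩, hts⟩
  have hltb : ∀ {t}, t ∈ I → φ t < b := by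
    intro t ht
    obtain ⟨s, hs, hts⟩ := hexists_gt ht
    exact (hφmono ht hs hts).trans_le (le_csSup hbdd (mem_image_of_mem φ hs))
  have himage : φ '' I = Ico (φ 0) b := by
    apply Subset.antisymm
    · rintro _ ⟨t, ht, rfl⟩
      exact ⟨hφmono.monotoneOn h0 ht ht.1, hltb ht⟩
    · rintro r ⟨h0r, hrb⟩
      obtain ⟨_, ⟨t, ht, rfl⟩, hrt⟩ := exists_lt_of_lt_csSup ⟨_, mem_image_of_mem φ h0⟩ hrb
      obtain ⟨s, hs, rfl⟩ := intermediate_value_Icc ht.1 (hφcont ht) ⟨h0r, hrt.le⟩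
      exact mem_image_of_mem φ (hsub ht hs)
  have hneBot : (comap (fun t : ℝ => (t : EReal)) (𝓝[<] c)).NeBot :=
    neBot_comap_coe_nhdsLT (bot_le.trans_lt hs₀.2)
  have hdistz : ∀ {s}, s ∈ I → dist (γ s) z ≤ b - φ s := by
    intro s hs
    refine le_of_tendsto (tendsto_const_nhds.dist hz) ?_
    filter_upwards [eventually_lt_comap_coe_nhdsLT hs.2] with t ht
    have htI : t ∈ I := ⟨hs.1.trans ht.1.le, ht.2⟩
    linarith [hdist hs htI ht.1.le, hltb htI]
  set ψ := Function.invFunOn φ I with hψ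
  have hψφ : ∀ {t}, t ∈ I → ψ (φ t) = t := fun ht => hφmono.injOn.leftInvOn_invFunOn ht
  set σ : ℝ → X := fun r => if r < b then γ (ψ r) else z with hσ
  have hσφ : ∀ {t}, t ∈ I → σ (φ t) = γ t := fun ht => by
    simp only [hσ, if_pos (hltb ht), hψφ ht]
  have hσb : σ b = z := if_neg (lt_irrefl b)
  have hcases : ∀ r ∈ Icc (φ 0) b, (∃ t ∈ I, φ t = r) ∨ r = b := by
    rintro r ⟨h0r, hrb⟩
    rcases hrb.lt_or_eq with hrb | rfl
    · have : r ∈ φ '' I := himage ▸ ⟨h0r, hrb⟩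
      exact Or.inl this
    · exact Or.inr rfl
  have hmemφ : ∀ {t}, t ∈ I → φ t ∈ Icc (φ 0) b := fun ht =>
    ⟨hφmono.monotoneOn h0 ht ht.1, (hltb ht).le⟩
  refine ⟨φ 0, b, σ, ⟨ordConnected_Icc, ⟨φ s₀, hmemφ hs₀, φ t₀, hmemφ ht₀, ?_⟩, ?_, ?_⟩,
    φ, hφmono, himage, fun t ht => (hσφ ht).symm⟩
  · rwa [hσφ hs₀, hσφ ht₀]
  · have hordered : ∀ q ∈ Icc (φ 0) b, ∀ r ∈ Icc (φ 0) b, q ≤ r → dist (σ q) (σ r) ≤ r - q := by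
      intro q hq r hr hqr
      rcases hcases q hq with ⟨s, hs, rfl⟩ | rfl
      · rcases hcases r hr with ⟨t, ht, rfl⟩ | rfl
        · rw [hσφ hs, hσφ ht]
          exact hdist hs ht ((hφmono.le_iff_le hs ht).1 hqr)
        · rw [hσφ hs, hσb]
          exact hdistz hs
      · rw [le_antisymm hr.2 hqr, dist_self, sub_self]
    suffices hσlip : LipschitzOnWith 1 σ (Icc (φ 0) b) from
       fun q _ => ⟨1, _, self_mem_nhdsWithin, hσlip⟩
    refine LipschitzOnWith.of_dist_le_mul fun q hq r hr => ?_
    rw [NNReal.coe_one, one_mul]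
    rcases le_total q r with hqr | hrq
    · rw [Real.dist_eq, abs_sub_comm, abs_of_nonneg (sub_nonneg.2 hqr)]
      exact hordered q hq r hr hqr
    · rw [Real.dist_eq, abs_of_nonneg (sub_nonneg.2 hrq), dist_comm]
      exact hordered r hr q hq hrq
  · intro q hq r hr hqr
    rcases hcases q hq with ⟨s, hs, rfl⟩ | rfl
    · rcases hcases r hr with ⟨t, ht, rfl⟩ | rfl
      · rw [hσφ hs, hσφ ht]
        exact hcausal s hs t ht ((hφmono.lt_iff_lt hs ht).1 hqr)
      · rw [hσφ hs, hσb]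
        exact hle s hs
    · exact absurd hr.2 hqr.not_ge

/-- The length is finite: the curve is Lipschitz on a compact initial segment, and its tail stays in
a neighbourhood of `z` where causal curves have bounded length. -/
theorem IsCausallyRegular.futureExtendible_of_tendsto (h : S.IsCausallyRegular) {c : EReal}
    {γ : ℝ → X} (hγ : S.IsFutureCausal γ (halfOpenInterval 0 c)) {z : X}
    (hz : Tendsto γ (comap (fun t : ℝ => (t : EReal)) (𝓝[<] c)) (𝓝 z)) :
    S.FutureExtendible γ 0 c := by
  obtain ⟨s₀, hs₀, -⟩ := hγ.2.1
  have h0 : ((0 : ℝ) : EReal) < c := (EReal.coe_le_coe_iff.2 hs₀.1).trans_lt hs₀.2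
  have hneBot : (comap (fun t : ℝ => (t : EReal)) (𝓝[<] c)).NeBot :=
    neBot_comap_coe_nhdsLT (bot_le.trans_lt h0)
  obtain ⟨U, hU, C, -, hC⟩ := h.exists_boundedCausalLengths z
  obtain ⟨a, haI, hmemU⟩ : ∃ a ∈ halfOpenInterval 0 c, ∀ t : ℝ, a ≤ t → (t : EReal) < c → γ t ∈ U := by
    obtain ⟨W, hW, hWU⟩ := hz hU
    obtain ⟨l, hl, hls⟩ := (mem_nhdsLT_iff_exists_Ioo_subset' h0).1 hW
    obtain ⟨a, hla, hac⟩ := EReal.lt_iff_exists_real_btwn.1 (max_lt hl h0)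
    refine ⟨a, ⟨(EReal.coe_lt_coe_iff.1 ((le_max_right _ _).trans_lt hla)).le, hac⟩,
      fun t hat htc => hWU (hls ⟨?_, htc⟩)⟩
    exact ((le_max_left _ _).trans_lt hla).trans_le (EReal.coe_le_coe_iff.2 hat)
  obtain ⟨K, hK⟩ := exists_eVariationOn_Icc_le_of_locallyLipschitzOn (a := 0) (b := a)
    (hγ.2.2.1.mono fun s hs => ⟨hs.1, (EReal.coe_le_coe_iff.2 hs.2).trans_lt haI.2⟩)
  refine LorentzianPreLengthSpace.futureExtendible_of_tendsto hγ hz (fun t ht => ?_)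
    (C := ENNReal.ofReal (K * (a - 0)) + C) (by finiteness) fun t ht => ?_
  · refine (h.isClosed_causal_right (γ t)).mem_of_tendsto hz ?_
    filter_upwards [eventually_lt_comap_coe_nhdsLT ht.2] with s hs
    exact hγ.2.2.2 t ht s ⟨ht.1.trans hs.1.le, hs.2⟩ hs.1
  · have hvar0 := hK 0 a le_rfl haI.1 le_rfl
    rcases le_total t a with hta | hat
    · exact ((eVariationOn.mono γ (Icc_subset_Icc_right hta)).trans hvar0).trans le_self_add
    · have hadd := eVariationOn.Icc_add_Icc γ (s := univ) haI.1 hat (mem_univ a)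
      simp only [univ_inter] at hadd
      rw [← hadd]
      refine add_le_add hvar0 ?_
      -- A constant segment is not a causal curve, so the length bound does not cover it; its
      -- variation is `0`.
      by_cases hconst : ∃ s ∈ Icc a t, ∃ r ∈ Icc a t, γ s ≠ γ r
      · have hsub : Icc a t ⊆ halfOpenInterval 0 c := fun s hs =>
          ⟨haI.1.trans hs.1, (EReal.coe_le_coe_iff.2 hs.2).trans_lt ht.2⟩
        exact hC a t γ (Or.inl ⟨ordConnected_Icc, hconst, hγ.2.2.1.mono hsub,
          fun s hs r hr => hγ.2.2.2 s (hsub hs) r (hsub hr)⟩)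
          fun s hs => hmemU s hs.1 (hsub hs).2
      · push Not at hconst
        rw [eVariationOn.constant_on]
        · exact zero_le
        · rintro _ ⟨s, hs, rfl⟩ _ ⟨r, hr, rfl⟩
          exact hconst s hs r hr

/-! ### Condition A and the conclusion -/

/-- Since `τ x` is nondecreasing along `γ`, exceeding each bound once suffices; a bound never
exceeded would make `γ` converge and thus extendible. -/
theorem IsCausallyRegular.tendsto_τ_of_future_timelikeCauchyComplete (h : S.IsCausallyRegular)
    (htcc : ∀ (x : ℕ → X) (B : ℕ → ℝ≥0), (∀ n, S.chron (x n) (x (n + 1))) →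
      (∀ n m, 0 < m → S.τ (x n) (x (n + m)) ≤ B n) → Tendsto B atTop (𝓝 0) →
      ∃ z, Tendsto x atTop (𝓝 z))
    {c : EReal} {x : X} {γ : ℝ → X} (hγ : S.IsFutureCausal γ (halfOpenInterval 0 c))
    (hinext : ¬ S.FutureExtendible γ 0 c) (hx : S.chron x (γ 0)) :
    Tendsto (fun t => S.τ x (γ t)) (comap (fun t : ℝ => (t : EReal)) (𝓝[<] c)) (𝓝 ⊤) := by
  obtain ⟨s₀, hs₀, -⟩ := hγ.2.1
  have hc : (0 : EReal) < c := (EReal.coe_le_coe_iff.2 hs₀.1).trans_lt hs₀.2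
  have h0 : (0 : ℝ) ∈ halfOpenInterval 0 c := ⟨le_rfl, hc⟩
  have hcausal : ∀ s ∈ halfOpenInterval 0 c, ∀ t ∈ halfOpenInterval 0 c, s ≤ t →
      S.causal (γ s) (γ t) := by
    intro s hs t ht hst
    rcases hst.eq_or_lt with rfl | hst
    · exact S.causal_refl _
    · exact hγ.2.2.2 s hs t ht hst
  refine ENNReal.tendsto_nhds_top_iff_nnreal.2 fun B => ?_
  obtain ⟨t, ht, hBt⟩ : ∃ t ∈ halfOpenInterval 0 c, (B : ℝ≥0∞) < S.τ x (γ t) := by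
    by_contra! hB
    obtain ⟨z, hz⟩ := h.exists_tendsto_of_future_timelikeCauchyComplete htcc hc hγ hx
      ENNReal.coe_ne_top hB
    exact hinext (h.futureExtendible_of_tendsto hγ hz)
  filter_upwards [eventually_lt_comap_coe_nhdsLT ht.2] with s hs
  exact hBt.trans_le (le_self_add.trans (S.reverse_triangle _ _ _
    (S.causal_of_chron _ _ (S.chron_of_chron_of_causal hx (hcausal 0 h0 t ht ht.1)))
    (hcausal t ht s ⟨ht.1.trans hs.1.le, hs.2⟩ hs.1.le)))

end LorentzianPreLengthSpace

theorem mainTheorem1 {X : Type*} [MetricSpace X] (S : LorentzianPreLengthSpace X)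
    (hS : S.IsLengthSpace) (hgh : S.GloballyHyperbolic) :
    (S.FinitelyCompact → S.TimelikeCauchyComplete) ∧
      (S.TimelikeCauchyComplete → S.ConditionA) := by
  have h := hS.isCausallyRegular hgh
  refine ⟨fun hfc => ⟨fun x B hx hB _ => ?_, fun x B hx hB _ => ?_⟩,
    fun htcc => ⟨fun c x y γ _ hxy hγ hinext hy => ?_, fun c x y γ _ hxy hγ hinext hy => ?_⟩⟩
  · exact h.tendsto_of_future_finitelyCompact hfc.1 hx hB
  -- The past statements for `S` are definitionally the future statements for `S.dual`.
  · exact h.dual.tendsto_of_future_finitelyCompact hfc.2 hx hB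
  · exact h.tendsto_τ_of_future_timelikeCauchyComplete htcc.1 hγ.1 hinext (hy ▸ hxy)
  · exact h.dual.tendsto_τ_of_future_timelikeCauchyComplete htcc.2 hγ.1 hinext (hy ▸ hxy)
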